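/- **Definitions.** Write $[m]=\{1,\dots,m\}$ and let $\llbracket P\rrbracket$ be $1$ if $P$ is true and $0$ otherwise. *Generalized Farey intervals.* For integers $m,n\ge 0$ let $G_{m,n}=\{0,\infty\}\cup\{p/q : p\in[m],\,q\in[n]\}$, let $\mathcal G_{m,n}$ be the set of all $((a,b),(m,n))$ such that $a<b$ are adjacent elements of $G_{m,n}$, and let $\check{\mathcal G}_k=\bigsqcup_{m,n\ge0,\ m+n=k}\mathcal G_{m,n}$. For $k\ge1$ the map $\check V_k:\check{\mathcal G}_k\to\check{\mathcal G}_{k-1}$ sends $((0,\infty),(0,n))$ to $((0,\infty),(0,n-1))$, sends $((0,\infty),(m,0))$ to $((0,\infty),(m-1,0))$, and, for $m,n\ge1$, sends $((a,b),(m,n))$ to $$\begin{cases}((a,b),(m-1,n)) & b<\frac mn,\\ ((a,\min\{c\in G_{m-1,n}:a<c\}),(m-1,n)) & b=\frac mn,\\ ((\max\{c\in G_{m,n-1}:c<b\},b),(m,n-1)) & a=\frac mn,\\ ((a,b),(m,n-1)) & a>\frac mn.\end{cases}$$ *Terminal pairs of difference equation type.* For $m,n\ge1$ let $\mathcal T^{1,\mathrm{in}}_{m,n}$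 be the set of all $(f(m,1),f(1,n),(m,n))$, where $f:([m]\times\{1\})\cup(\{1\}\times[n])\to[mn]$ is an injection with $f(1,1)=1$, $$f(i+1,1)-f(i,1)=\sum_{t\in[n]}\llbracket f(1,t)\le f(i+1,1)\rrbracket\ (i\in[m-1]),\qquad f(1,j+1)-f(1,j)=\sum_{s\in[m]}\llbracket f(s,1)\le f(1,j+1)\rrbracket\ (j\in[n-1]).$$ Let $\check{\mathcal T}_k=\bigsqcup_{m,n\ge1,\ m+n=k}\mathcal T^{1,\mathrm{in}}_{m,n}$, and for $k\ge3$ let $\check u_k:\check{\mathcal T}_k\to\check{\mathcal T}_{k-1}$ send $(s,t,(m,n))$ to $(s-n,t,(m-1,n))$ if $s>t$ and to $(s,t-m,(m,n-1))$ if $s<t$. *Young terminal pairs.* For $m,n\ge1$ and real $\xi>0$ let $\tau_\xi^{m,n}(i,j)=\sum_{s\in[m]}\sum_{t\in[n]}\llbracket s+t\xi\le i+j\xi\rrbracket$ for $(i,j)\in[m]\times[n]$; it is a Young ranking table if it is injective. Let $\mathrm{TY}_{m,n}$ be the set of all $(\theta(m,1),\theta(1,n),(m,n))$ with $\theta$ a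 Young ranking table of size $(m,n)$, and $\check{\mathrm{TY}}_k=\bigsqcup_{m,n\ge1,\ m+n=k}\mathrm{TY}_{m,n}$. The map $\check{\mathrm{ST}}_{k+1}:\check{\mathcal G}_{k}\to\check{\mathrm{TY}}_{k+2}$ ($k\ge0$) sends $((a,b),(m,n))$ to $(\tau_\xi^{m+1,n+1}(m+1,1),\tau_\xi^{m+1,n+1}(1,n+1),(m+1,n+1))$ for an arbitrary $\xi\in(a,b)$. For $k\ge2$ let $\check\phi_{k+1}=\check{\mathrm{ST}}_{k-1}\circ\check V_{k-1}\circ\check{\mathrm{ST}}_k^{-1}:\check{\mathrm{TY}}_{k+1}\to\check{\mathrm{TY}}_k$. *Trees.* For $N\ge0$ let $\mathbb T_N^{\check{\mathrm{TY}},\check\phi}$ (resp. $\mathbb T_N^{\check{\mathcal T},\check u}$) be the rooted tree with root $(1,1,(1,1))$, whose vertices of level $k$, $0\le k\le N$, are the elements of $\check{\mathrm{TY}}_{k+2}$ (resp. $\check{\mathcal T}_{k+2}$), and in which $v$ of level $k$ and $v'$ of level $k'>k$ are adjacent if and only if $k'=k+1$ and $\check\phi_{k'+2}(v')=v$ (resp.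 $\check u_{k'+2}(v')=v$). **Theorem 1.** All these objects are well defined: the maps $\check V_k$, $\check u_k$, $\check\phi_k$ take values in the sets indicated, $\check{\mathrm{ST}}_{k+1}$ does not depend on the choice of $\xi$ and is a bijection from $\check{\mathcal G}_k$ onto $\check{\mathrm{TY}}_{k+2}$, and $\check{\mathrm{TY}}_2=\check{\mathcal T}_2=\{(1,1,(1,1))\}$. For every integer $N\ge0$, $$\mathbb T_N^{\check{\mathrm{TY}},\check\phi}=\mathbb T_N^{\check{\mathcal T},\check u}$$ (the same root, the same vertices on each level, the same adjacency). In particular $\mathrm{TY}_{m,n}=\mathcal T^{1,\mathrm{in}}_{m,n}$ for all $m,n\ge1$. Moreover, for all $k\ge2$, $\check{\mathrm{TY}}_{k+1}=\check{\mathcal T}_{k+1}$ and $\check\phi_{k+1}=\check u_{k+1}$. -/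

import Mathlib

/-! ### Generalized Farey intervals -/

/-- The set `G_{m,n}` of generalized Farey fractions, inside the extended reals:
`0`, `∞` and all `p / q` with `1 ≤ p ≤ m`, `1 ≤ q ≤ n` (there are none if `m * n = 0`). -/
def fareySet (m n : ℕ) : Set EReal :=
  {0, ⊤} ∪ {x | ∃ p ∈ Set.Icc 1 m, ∃ q ∈ Set.Icc 1 n, x = (((p : ℝ) / (q : ℝ) : ℝ) : EReal)}

/-- `(a, b)` is an open interval between two adjacent elements of `G_{m,n}`. -/
def IsFareyInterval (m n : ℕ) (a b : EReal) : Prop :=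
  a ∈ fareySet m n ∧ b ∈ fareySet m n ∧ a < b ∧ ∀ c ∈ fareySet m n, ¬(a < c ∧ c < b)

/-- An interval `(a, b)`, given by its end points, tagged with a pair `(m, n)`. -/
@[ext]
structure TaggedInterval where
  a : EReal
  b : EReal
  m : ℕ
  n : ℕ

/-- The generalized Farey intervals with tag `(m, n)`. -/
def fareyVertices (m n : ℕ) : Set TaggedInterval :=
  {z | z.m = m ∧ z.n = n ∧ IsFareyInterval m n z.a z.b}

/-- Level `k`: the generalized Farey intervals with tags `(m, n)`, `m, n ≥ 0`, `m + n = k`. -/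
def fareyLevel (k : ℕ) : Set TaggedInterval :=
  {z | ∃ m n : ℕ, m + n = k ∧ z ∈ fareyVertices m n}

/-- The inter-level map `V` of the generalized Farey intervals, meaningful on `fareyLevel (k + 1)`.
The `sInf` (`sSup`) is that of a finite nonempty set, hence a minimum (maximum). The last branch
is the case `m / n < a`. -/
noncomputable def fareyV (z : TaggedInterval) : TaggedInterval :=
  if z.m = 0 then ⟨0, ⊤, 0, z.n - 1⟩
  else if z.n = 0 then ⟨0, ⊤, z.m - 1, 0⟩
  else
    let r : EReal := (((z.m : ℝ) / (z.n : ℝ) : ℝ) : EReal)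
    if z.b < r then ⟨z.a, z.b, z.m - 1, z.n⟩
    else if z.b = r then ⟨z.a, sInf {c | c ∈ fareySet (z.m - 1) z.n ∧ z.a < c}, z.m - 1, z.n⟩
    else if z.a = r then ⟨sSup {c | c ∈ fareySet z.m (z.n - 1) ∧ c < z.b}, z.b, z.m, z.n - 1⟩
    else ⟨z.a, z.b, z.m, z.n - 1⟩

/-! ### Terminal pairs of difference equation type -/

/-- The vertices `(s, t, (m, n))` of the two trees of terminal pairs. -/
@[ext]
structure TerminalPair where
  s : ℤ
  t : ℤ
  m : ℕ
  n : ℕ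

/-- The index set `([m] × {1}) ∪ ({1} × [n])` of an L-shape. -/
def lShape (m n : ℕ) : Set (ℕ × ℕ) :=
  (Set.Icc 1 m ×ˢ {1}) ∪ ({1} ×ˢ Set.Icc 1 n)

/-- The difference equation `E_{m,n}`. Only the values of `f` on `lShape m n` are read. -/
def DiffEq (m n : ℕ) (f : ℕ × ℕ → ℤ) : Prop :=
  (∀ i ∈ Set.Icc 1 (m - 1),
    f (i + 1, 1) - f (i, 1) = ∑ t ∈ Finset.Icc 1 n, if f (1, t) ≤ f (i + 1, 1) then 1 else 0) ∧
  (∀ j ∈ Set.Icc 1 (n - 1),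
    f (1, j + 1) - f (1, j) = ∑ s ∈ Finset.Icc 1 m, if f (s, 1) ≤ f (1, j + 1) then 1 else 0)

/-- `f`, restricted to `lShape m n`, is an injective L-shape of difference equation type: an
injection into `[mn]` satisfying `E_{m,n}` and `f (1, 1) = 1`. -/
def IsDiffLShape (m n : ℕ) (f : ℕ × ℕ → ℤ) : Prop :=
  Set.MapsTo f (lShape m n) (Set.Icc 1 ((m : ℤ) * (n : ℤ))) ∧ Set.InjOn f (lShape m n) ∧
    DiffEq m n f ∧ f (1, 1) = 1

/-- The terminal pairs of difference equation type of size `(m, n)`, for `m, n ≥ 1`. -/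
def diffPairs (m n : ℕ) : Set TerminalPair :=
  {x | ∃ f : ℕ × ℕ → ℤ, IsDiffLShape m n f ∧ x = ⟨f (m, 1), f (1, n), m, n⟩}

/-- The union of the sets of terminal pairs of difference equation type of the sizes `(m, n)`
with `m, n ≥ 1` and `m + n = k`. -/
def diffLevel (k : ℕ) : Set TerminalPair :=
  {x | ∃ m n : ℕ, 1 ≤ m ∧ 1 ≤ n ∧ m + n = k ∧ x ∈ diffPairs m n}

/-- The inter-level map `u`, meaningful on `diffLevel (k + 1)` for `k ≥ 2`, where `s ≠ t`. -/
def diffU (x : TerminalPair) : TerminalPair :=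
  if x.t < x.s then ⟨x.s - x.n, x.t, x.m - 1, x.n⟩
  else if x.s < x.t then ⟨x.s, x.t - x.m, x.m, x.n - 1⟩
  else x

/-! ### Young terminal pairs -/

/-- The table `τ_{1,ξ}^{m,n}`. Only its values on `[m] × [n]` are read. -/
noncomputable def rankTable (m n : ℕ) (ξ : ℝ) (p : ℕ × ℕ) : ℤ :=
  ∑ s ∈ Finset.Icc 1 m, ∑ t ∈ Finset.Icc 1 n,
    if (s : ℝ) + (t : ℝ) * ξ ≤ (p.1 : ℝ) + (p.2 : ℝ) * ξ then 1 else 0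

/-- `θ`, restricted to `[m] × [n]`, is a Young ranking table. -/
def IsYoungTable (m n : ℕ) (θ : ℕ × ℕ → ℤ) : Prop :=
  (∃ ξ : ℝ, 0 < ξ ∧ Set.EqOn θ (rankTable m n ξ) (Set.Icc 1 m ×ˢ Set.Icc 1 n)) ∧
    Set.InjOn θ (Set.Icc 1 m ×ˢ Set.Icc 1 n)

/-- The Young terminal pairs of size `(m, n)`, for `m, n ≥ 1`. -/
def youngPairs (m n : ℕ) : Set TerminalPair :=
  {x | ∃ θ : ℕ × ℕ → ℤ, IsYoungTable m n θ ∧ x = ⟨θ (m, 1), θ (1, n), m, n⟩}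

/-- The union of the sets of Young terminal pairs of the sizes `(m, n)` with `m, n ≥ 1` and
`m + n = k`. -/
def youngLevel (k : ℕ) : Set TerminalPair :=
  {x | ∃ m n : ℕ, 1 ≤ m ∧ 1 ≤ n ∧ m + n = k ∧ x ∈ youngPairs m n}

/-- The terminal pair, tagged with its size, of the table `τ_{1,ξ}^{m,n}`. -/
noncomputable def rankPair (m n : ℕ) (ξ : ℝ) : TerminalPair :=
  ⟨rankTable m n ξ (m, 1), rankTable m n ξ (1, n), m, n⟩

/-- The Surányi type map: an interval `(a, b)` with tag `(m, n)` goes to the terminal pair of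
`τ_{1,ξ}^{m+1,n+1}`, where `ξ` is an arbitrary real number in `(a, b)`. -/
noncomputable def suranyi (z : TaggedInterval) : TerminalPair :=
  rankPair (z.m + 1) (z.n + 1) (Classical.epsilon fun ξ : ℝ => z.a < (ξ : EReal) ∧ (ξ : EReal) < z.b)

/-- The inter-level map `φ_k = ST ∘ V ∘ ST⁻¹` from `youngLevel k` to `youngLevel (k - 1)`, for
`k ≥ 3`, where `ST⁻¹` is the inverse of the map `suranyi` from `fareyLevel (k - 2)`
to `youngLevel k`. -/
noncomputable def youngPhi (k : ℕ) (y : TerminalPair) : TerminalPair :=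
  haveI : Nonempty TaggedInterval := ⟨⟨0, ⊤, 0, 0⟩⟩
  suranyi (fareyV (Function.invFunOn suranyi (fareyLevel (k - 2)) y))

/-! ### Trees -/

/-- The data of a rooted tree with vertices in `α`: the root, the sets of vertices of level `k`
(empty beyond the height) and the adjacency of vertices. -/
@[ext]
structure LeveledRootedTree (α : Type) where
  root : α
  level : ℕ → Set α
  Adj : α → α → Prop

/-- The rooted tree of height `N` of a sequence `L 0 = {r}, L 1, …, L N` of pairwise disjoint sets
with maps `p (k + 1) : L (k + 1) → L k`: the vertices of level `k` are the elements of `L k`, and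
the edges join each `w ∈ L (k + 1)` with its parent `p (k + 1) w ∈ L k`. -/
def treeOfLevels {α : Type} (N : ℕ) (r : α) (L : ℕ → Set α) (p : ℕ → α → α) : LeveledRootedTree α where
  root := r
  level k := {v | k ≤ N ∧ v ∈ L k}
  Adj v w := ∃ k < N,
    (v ∈ L k ∧ w ∈ L (k + 1) ∧ p (k + 1) w = v) ∨ (w ∈ L k ∧ v ∈ L (k + 1) ∧ p (k + 1) v = w)

/-- The tree of height `N` of terminal pairs of difference equation type. -/
def diffTree (N : ℕ) : LeveledRootedTree TerminalPair :=
  treeOfLevels N ⟨1, 1, 1, 1⟩ (fun k => diffLevel (k + 2)) (fun _ => diffU)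

/-- The tree of height `N` of Young terminal pairs. -/
noncomputable def youngTree (N : ℕ) : LeveledRootedTree TerminalPair :=
  treeOfLevels N ⟨1, 1, 1, 1⟩ (fun k => youngLevel (k + 2)) (fun k => youngPhi (k + 2))

/-! ### Rank tables -/

/-! Everything is reduced to the real parameter `ξ`, where the point `(i, j)` of the grid has the
value `i + j * ξ` and a rank table counts the points of no larger value. Differences of coordinates
in a grid of size `(m + 1, n + 1)` are at most `m` and `n`, so the order of these values depends
only on the side of each fraction `p / q`, `p ≤ m`, `q ≤ n`, on which `ξ` lies: on the Farey
interval of `ξ`. Conversely, the terminal pair `(s, t)` recovers this interval: `t < s` says that `ξ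
< m / n`, and `diffU` then gives the terminal pair of the same `ξ` for a smaller grid, so induction
applies (`sameSide_of_rankPair_eq`). Hence `suranyi` is a bijection. Since `fareyV` shortens the
same axis and only enlarges the interval, one `ξ` serves before and after, and `suranyi` intertwines
`fareyV` with `diffU`.

It remains to see that the two kinds of pairs coincide. A rank table solves the difference equation,
because a step along an axis adds at most one point to each line parallel to that axis. For the
converse, remove the end of the longer-valued arm of an L-shape; by induction the remaining pair
comes from some `ξ`. To restore the end, `ξ` must move within its Farey interval below a new
fraction. An obstruction would be an old fraction below `ξ` that is not below the new one, and
`rankTable_add_le_of_fraction` shows by counting that it would make the other arm too large. -/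

theorem rankTable_eq_sum_rows (m n : ℕ) (ξ : ℝ) (p : ℕ × ℕ) :
    rankTable m n ξ p = ∑ t ∈ Finset.Icc 1 n,
      (((Finset.Icc 1 m).filter fun s : ℕ =>
        (s : ℝ) + (t : ℝ) * ξ ≤ (p.1 : ℝ) + (p.2 : ℝ) * ξ).card : ℤ) := by
  rw [rankTable, Finset.sum_comm]
  simp

theorem rankTable_eq_card (m n : ℕ) (ξ : ℝ) (p : ℕ × ℕ) :
    rankTable m n ξ p = (((Finset.Icc 1 m ×ˢ Finset.Icc 1 n).filter fun q : ℕ × ℕ =>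
        (q.1 : ℝ) + (q.2 : ℝ) * ξ ≤ (p.1 : ℝ) + (p.2 : ℝ) * ξ).card : ℤ) := by
  rw [rankTable, ← Finset.sum_product']
  simp

theorem rankTable_mono {m n : ℕ} {ξ : ℝ} {p q : ℕ × ℕ}
    (h : (p.1 : ℝ) + p.2 * ξ ≤ q.1 + q.2 * ξ) : rankTable m n ξ p ≤ rankTable m n ξ q := by
  rw [rankTable_eq_card, rankTable_eq_card]
  norm_cast
  exact Finset.card_le_card (Finset.monotone_filter_right _ fun _ _ hr => hr.trans h)

theorem rankTable_lt {m n : ℕ} {ξ : ℝ} {p q : ℕ × ℕ}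
    (hq : q ∈ Set.Icc 1 m ×ˢ Set.Icc 1 n) (h : (p.1 : ℝ) + p.2 * ξ < q.1 + q.2 * ξ) :
    rankTable m n ξ p < rankTable m n ξ q := by
  rw [rankTable_eq_card, rankTable_eq_card]
  norm_cast
  refine Finset.card_lt_card ((Finset.ssubset_iff_of_subset
    (Finset.monotone_filter_right _ fun _ _ hr => hr.trans h.le)).2 ⟨q, ?_, ?_⟩)
  · exact Finset.mem_filter.2
      ⟨Finset.mem_product.2 ⟨Finset.mem_Icc.2 hq.1, Finset.mem_Icc.2 hq.2⟩, le_rfl⟩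
  · simp [h]

theorem rankTable_le_iff {m n : ℕ} {ξ : ℝ} {p q : ℕ × ℕ} (hp : p ∈ Set.Icc 1 m ×ˢ Set.Icc 1 n) :
    rankTable m n ξ p ≤ rankTable m n ξ q ↔ (p.1 : ℝ) + p.2 * ξ ≤ q.1 + q.2 * ξ :=
  ⟨fun h => not_lt.1 fun h' => (rankTable_lt hp h').not_ge h, rankTable_mono⟩

theorem rankTable_mem_Icc {m n : ℕ} {ξ : ℝ} {p : ℕ × ℕ} (hp : p ∈ Set.Icc 1 m ×ˢ Set.Icc 1 n) :
    rankTable m n ξ p ∈ Set.Icc (1 : ℤ) (m * n) := by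
  rw [rankTable_eq_card]
  constructor
  · norm_cast
    exact Finset.card_pos.2 ⟨p, Finset.mem_filter.2
      ⟨Finset.mem_product.2 ⟨Finset.mem_Icc.2 hp.1, Finset.mem_Icc.2 hp.2⟩, le_rfl⟩⟩
  · norm_cast
    refine (Finset.card_filter_le _ _).trans (by simp)

theorem rankTable_one_one {m n : ℕ} (hm : 1 ≤ m) (hn : 1 ≤ n) {ξ : ℝ} (hξ : 0 < ξ) :
    rankTable m n ξ (1, 1) = 1 := by
  rw [rankTable_eq_card]
  norm_cast
  rw [Finset.card_eq_one]
  refine ⟨(1, 1), ?_⟩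
  ext ⟨s, t⟩
  simp only [Finset.mem_filter, Finset.mem_product, Finset.mem_Icc, Finset.mem_singleton,
    Prod.mk.injEq]
  constructor
  · rintro ⟨⟨⟨hs, -⟩, ht, -⟩, h⟩
    have hs' : (1 : ℝ) ≤ s := by exact_mod_cast hs
    have ht' : (1 : ℝ) ≤ t := by exact_mod_cast ht
    push_cast at h
    constructor
    · have : (s : ℝ) ≤ 1 := by nlinarith
      exact le_antisymm (by exact_mod_cast this) hs
    · have : (t : ℝ) ≤ 1 := by
        by_contra! h'
        nlinarith [mul_lt_mul_of_pos_right h' hξ]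
      exact le_antisymm (by exact_mod_cast this) ht
  · rintro ⟨rfl, rfl⟩
    simp [hm, hn]

/-- Dividing all values by `ξ` exchanges the axes. Through this symmetry only one arm of an L-shape
needs an argument. -/
theorem rankTable_swap (m n : ℕ) {ξ : ℝ} (hξ : 0 < ξ) (p : ℕ × ℕ) :
    rankTable n m ξ⁻¹ p.swap = rankTable m n ξ p := by
  rw [rankTable, rankTable, Finset.sum_comm]
  refine Finset.sum_congr rfl fun s _ => Finset.sum_congr rfl fun t _ => ?_
  congr 1
  simp only [Prod.fst_swap, Prod.snd_swap, eq_iff_iff]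
  rw [← mul_le_mul_iff_of_pos_right hξ, add_mul, add_mul, mul_assoc, mul_assoc,
    inv_mul_cancel₀ hξ.ne', mul_one, mul_one, add_comm, add_comm (_ * ξ)]

/-- The bound `y < m` ensures that the integer gained, `⌊y⌋₊ + 1`, is not cut off by the end of the
range. -/
theorem card_filter_Icc_le_add_one {m : ℕ} {y : ℝ} (hy : y < m) :
    (((Finset.Icc 1 m).filter fun s : ℕ => (s : ℝ) ≤ y + 1).card : ℤ) =
      ((Finset.Icc 1 m).filter fun s : ℕ => (s : ℝ) ≤ y).card + if 0 ≤ y then 1 else 0 := by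
  by_cases h0 : 0 ≤ y
  · have hcount : ∀ z : ℝ, 0 ≤ z → z < m + 1 →
        (Finset.Icc 1 m).filter (fun s : ℕ => (s : ℝ) ≤ z) = Finset.Icc 1 ⌊z⌋₊ := by
      intro z hz hzm
      ext s
      have : ⌊z⌋₊ < m + 1 := (Nat.floor_lt hz).2 (by exact_mod_cast hzm)
      simp only [Finset.mem_filter, Finset.mem_Icc, ← Nat.le_floor_iff hz]
      omega
    rw [hcount _ (by linarith) (by linarith), hcount _ h0 (by linarith), Nat.floor_add_one h0]
    simp [h0]
  · have hempty : ∀ z : ℝ, z < 1 → (Finset.Icc 1 m).filter (fun s : ℕ => (s : ℝ) ≤ z) = ∅ := by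
      intro z hz
      refine Finset.filter_eq_empty_iff.2 fun s hs => ?_
      have : (1 : ℝ) ≤ s := by exact_mod_cast (Finset.mem_Icc.1 hs).1
      linarith
    rw [hempty _ (by linarith), hempty _ (by linarith)]
    simp [h0]

/-- Raising the threshold by `1` adds one point to row `t` exactly when `1 + t * ξ` is at most the
new threshold `i + 1 + ξ`. This is the comparison of `(1, t)` with `(i + 1, 1)` in the difference
equation. -/
theorem rankTable_succ_sub {m n i : ℕ} {ξ : ℝ} (hξ : 0 < ξ) (hi : i < m) :
    rankTable m n ξ (i + 1, 1) - rankTable m n ξ (i, 1) =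
      ∑ t ∈ Finset.Icc 1 n, if (t : ℝ) * ξ ≤ i + ξ then 1 else 0 := by
  rw [rankTable_eq_sum_rows, rankTable_eq_sum_rows, ← Finset.sum_sub_distrib]
  refine Finset.sum_congr rfl fun t ht => ?_
  have ht1 : (1 : ℝ) ≤ t := by exact_mod_cast (Finset.mem_Icc.1 ht).1
  have him : (i : ℝ) + 1 ≤ m := by exact_mod_cast hi
  have key := card_filter_Icc_le_add_one (m := m) (y := i + ξ - t * ξ) (by nlinarith)
  have e1 : ∀ s : ℕ, (s : ℝ) + t * ξ ≤ ((i + 1 : ℕ) : ℝ) + ((1 : ℕ) : ℝ) * ξ ↔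
      (s : ℝ) ≤ i + ξ - t * ξ + 1 := fun s => by
    push_cast
    constructor <;> intro h <;> linarith
  have e2 : ∀ s : ℕ, (s : ℝ) + t * ξ ≤ (i : ℝ) + ((1 : ℕ) : ℝ) * ξ ↔
      (s : ℝ) ≤ i + ξ - t * ξ := fun s => by
    push_cast
    constructor <;> intro h <;> linarith
  simp only [e1, e2, key, sub_nonneg]
  ring

theorem rankTable_diffEq_left {m n i : ℕ} {ξ : ℝ} (hξ : 0 < ξ) (hi : i < m) :
    rankTable m n ξ (i + 1, 1) - rankTable m n ξ (i, 1) =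
      ∑ t ∈ Finset.Icc 1 n,
        if rankTable m n ξ (1, t) ≤ rankTable m n ξ (i + 1, 1) then 1 else 0 := by
  rw [rankTable_succ_sub hξ hi]
  refine Finset.sum_congr rfl fun t ht => ?_
  have hmem : (1, t) ∈ Set.Icc 1 m ×ˢ Set.Icc 1 n :=
    ⟨⟨le_rfl, show 1 ≤ m by omega⟩, Finset.mem_Icc.1 ht⟩
  refine if_congr ?_ rfl rfl
  rw [rankTable_le_iff hmem]
  push_cast
  constructor <;> intro h <;> linarith

theorem rankTable_diffEq (m n : ℕ) {ξ : ℝ} (hξ : 0 < ξ) : DiffEq m n (rankTable m n ξ) := by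
  constructor
  · rintro i ⟨h1, h2⟩
    exact rankTable_diffEq_left hξ (by omega)
  · rintro j ⟨h1, h2⟩
    have := rankTable_diffEq_left (m := n) (n := m) (i := j) (inv_pos.2 hξ) (by omega)
    simpa only [← rankTable_swap m n hξ, Prod.swap_prod_mk] using this

theorem rankTable_succ_left_of_lt {m n : ℕ} {ξ : ℝ} (hξ : 0 < ξ) {p : ℕ × ℕ}
    (hp : (p.1 : ℝ) + p.2 * ξ < m + 1 + ξ) : rankTable (m + 1) n ξ p = rankTable m n ξ p := by
  rw [rankTable, rankTable, Finset.sum_Icc_succ_top (by omega), add_eq_left]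
  refine Finset.sum_eq_zero fun t ht => if_neg ?_
  have ht1 : (1 : ℝ) ≤ t := by exact_mod_cast (Finset.mem_Icc.1 ht).1
  push_cast
  nlinarith

/-! ### Terminal pairs of rank tables -/

/-- The terminal pair with the two axes exchanged. -/
def TerminalPair.swap (x : TerminalPair) : TerminalPair := ⟨x.t, x.s, x.n, x.m⟩

theorem rankPair_swap (m n : ℕ) {ξ : ℝ} (hξ : 0 < ξ) :
    rankPair n m ξ⁻¹ = (rankPair m n ξ).swap := by
  simp only [rankPair, TerminalPair.swap, ← rankTable_swap m n hξ, Prod.swap_prod_mk]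

theorem diffU_swap (x : TerminalPair) : diffU x.swap = (diffU x).swap := by
  rcases lt_trichotomy x.s x.t with h | h | h
  · simp [diffU, TerminalPair.swap, h, h.not_gt]
  · simp [diffU, TerminalPair.swap, h]
  · simp [diffU, TerminalPair.swap, h, h.not_gt]

theorem rankPair_lt_of_mul_lt {m n : ℕ} (hn : 1 ≤ n) {ξ : ℝ} (h : ((n : ℝ) - 1) * ξ < m) :
    (rankPair (m + 1) n ξ).t < (rankPair (m + 1) n ξ).s := by
  refine rankTable_lt (by simpa using hn) ?_
  push_cast
  linarith

/-- The hypothesis puts the value of `(1, n)` below that of `(m + 1, 1)`. So all `n` rows contribute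
to the last step of the first arm, and the new points `(m + 1, t)` are too large to affect the other
ranks involved. -/
theorem rankPair_succ_left {m n : ℕ} {ξ : ℝ} (hξ : 0 < ξ)
    (h : ((n : ℝ) - 1) * ξ < m) :
    rankPair (m + 1) n ξ = ⟨(rankPair m n ξ).s + n, (rankPair m n ξ).t, m + 1, n⟩ := by
  have h1 : rankTable (m + 1) n ξ (m + 1, 1) - rankTable (m + 1) n ξ (m, 1) = n := by
    rw [rankTable_succ_sub hξ (Nat.lt_succ_self m), Finset.sum_congr rfl fun t ht => if_pos ?_]
    · simp
    · have : (t : ℝ) ≤ n := by exact_mod_cast (Finset.mem_Icc.1 ht).2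
      nlinarith
  rw [rankTable_succ_left_of_lt (p := (m, 1)) hξ (by push_cast; linarith)] at h1
  simp only [rankPair, TerminalPair.mk.injEq, and_true]
  refine ⟨by linarith, ?_⟩
  exact rankTable_succ_left_of_lt hξ (by push_cast; linarith)

theorem diffU_rankPair_of_mul_lt {m n : ℕ} (hn : 1 ≤ n) {ξ : ℝ} (hξ : 0 < ξ)
    (h : ((n : ℝ) - 1) * ξ < m) : diffU (rankPair (m + 1) n ξ) = rankPair m n ξ := by
  rw [diffU, if_pos (rankPair_lt_of_mul_lt hn h), rankPair_succ_left hξ h]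
  simp [rankPair]

theorem lt_sub_one_mul_inv {m n : ℝ} {ξ : ℝ} (hξ : 0 < ξ) (h : m - 1 < n * ξ) :
    (m - 1) * ξ⁻¹ < n := by
  rwa [← div_eq_mul_inv, div_lt_iff₀ hξ]

theorem diffU_rankPair_of_lt_mul {m n : ℕ} (hm : 1 ≤ m) {ξ : ℝ} (hξ : 0 < ξ)
    (h : (m : ℝ) - 1 < n * ξ) : diffU (rankPair m (n + 1) ξ) = rankPair m n ξ := by
  have := diffU_rankPair_of_mul_lt hm (inv_pos.2 hξ) (lt_sub_one_mul_inv hξ h)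
  rw [rankPair_swap _ _ hξ, rankPair_swap _ _ hξ, diffU_swap] at this
  exact congrArg TerminalPair.swap this

theorem rankPair_lt_of_lt_mul {m n : ℕ} (hm : 1 ≤ m) {ξ : ℝ} (h : (m : ℝ) - 1 < n * ξ) :
    (rankPair m (n + 1) ξ).s < (rankPair m (n + 1) ξ).t := by
  refine rankTable_lt (by simpa using hm) ?_
  push_cast
  linarith

/-! ### The parameters of a rank table -/

/-- `ξ` is positive and none of the fractions `p / q` with `p ∈ [m]`, `q ∈ [n]`. -/
def AvoidsFractions (m n : ℕ) (ξ : ℝ) : Prop :=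
  0 < ξ ∧ ∀ p ∈ Set.Icc 1 m, ∀ q ∈ Set.Icc 1 n, (p : ℝ) ≠ q * ξ

/-- No fraction `p / q` with `p ∈ [m]`, `q ∈ [n]` separates `ξ` and `η`. -/
def SameSide (m n : ℕ) (ξ η : ℝ) : Prop :=
  ∀ p ∈ Set.Icc 1 m, ∀ q ∈ Set.Icc 1 n, (p : ℝ) < q * ξ ↔ (p : ℝ) < q * η

theorem AvoidsFractions.mono {m n m' n' : ℕ} {ξ : ℝ} (h : AvoidsFractions m n ξ) (hm : m' ≤ m)
    (hn : n' ≤ n) : AvoidsFractions m' n' ξ :=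
  ⟨h.1, fun p hp q hq => h.2 p ⟨hp.1, hp.2.trans hm⟩ q ⟨hq.1, hq.2.trans hn⟩⟩

theorem Irrational.avoidsFractions {ξ : ℝ} (h : Irrational ξ) (hξ : 0 < ξ) (m n : ℕ) :
    AvoidsFractions m n ξ := by
  refine ⟨hξ, fun p hp q hq hpq => (h.natCast_mul (m := q) (by have := hq.1; omega)).ne_nat p ?_⟩
  exact hpq.symm

/-- Only when the coordinates differ in opposite directions does the comparison depend on the
parameter. It then compares a fraction `p / q` with it, `p ≤ m` and `q ≤ n` being the differences of
coordinates. -/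
theorem SameSide.le_of_le {m n : ℕ} {ξ η : ℝ} (hξ : AvoidsFractions m n ξ)
    (hη : AvoidsFractions m n η) (h : SameSide m n ξ η) {p q : ℕ × ℕ}
    (hp : p ∈ Set.Icc 1 (m + 1) ×ˢ Set.Icc 1 (n + 1))
    (hq : q ∈ Set.Icc 1 (m + 1) ×ˢ Set.Icc 1 (n + 1))
    (hpq : (p.1 : ℝ) + p.2 * ξ ≤ q.1 + q.2 * ξ) : (p.1 : ℝ) + p.2 * η ≤ q.1 + q.2 * η := by
  obtain ⟨s, t⟩ := p
  obtain ⟨i, j⟩ := q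
  obtain ⟨⟨hs1, hs2⟩, ht1, ht2⟩ := hp
  obtain ⟨⟨hi1, hi2⟩, hj1, hj2⟩ := hq
  dsimp only at *
  have h0 := hξ.1
  have h0' := hη.1
  rcases le_or_gt s i with hsi | hsi <;> rcases le_or_gt t j with htj | htj
  · have h1 : (s : ℝ) ≤ i := by exact_mod_cast hsi
    have h2 : (t : ℝ) ≤ j := by exact_mod_cast htj
    nlinarith
  · obtain ⟨d, rfl⟩ := Nat.exists_eq_add_of_lt htj
    obtain ⟨c, rfl⟩ := Nat.exists_eq_add_of_le hsi
    rcases Nat.eq_zero_or_pos c with rfl | hc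
    · push_cast at hpq
      have : (0 : ℝ) ≤ d := d.cast_nonneg
      nlinarith
    · have := not_congr (h c ⟨hc, by omega⟩ (d + 1) ⟨by omega, by omega⟩)
      push_cast at this hpq ⊢
      have h3 := this.1 (by nlinarith)
      nlinarith
  · obtain ⟨d, rfl⟩ := Nat.exists_eq_add_of_le htj
    obtain ⟨c, rfl⟩ := Nat.exists_eq_add_of_lt hsi
    rcases Nat.eq_zero_or_pos d with rfl | hd
    · push_cast at hpq
      have : (0 : ℝ) ≤ c := c.cast_nonneg
      nlinarith
    · have h3 := h (c + 1) ⟨by omega, by omega⟩ d ⟨hd, by omega⟩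
      have h4 := hξ.2 (c + 1) ⟨by omega, by omega⟩ d ⟨hd, by omega⟩
      push_cast at h3 h4 hpq ⊢
      have h5 := h3.1 (lt_of_le_of_ne (by nlinarith) h4)
      nlinarith
  · have h1 : (i : ℝ) < s := by exact_mod_cast hsi
    have h2 : (j : ℝ) < t := by exact_mod_cast htj
    nlinarith

theorem SameSide.symm {m n : ℕ} {ξ η : ℝ} (h : SameSide m n ξ η) : SameSide m n η ξ :=
  fun p hp q hq => (h p hp q hq).symm

theorem SameSide.rankTable_eq {m n : ℕ} {ξ η : ℝ} (hξ : AvoidsFractions m n ξ)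
    (hη : AvoidsFractions m n η) (h : SameSide m n ξ η) {p : ℕ × ℕ}
    (hp : p ∈ Set.Icc 1 (m + 1) ×ˢ Set.Icc 1 (n + 1)) :
    rankTable (m + 1) (n + 1) ξ p = rankTable (m + 1) (n + 1) η p := by
  refine Finset.sum_congr rfl fun s hs => Finset.sum_congr rfl fun t ht => ?_
  have hst : (s, t) ∈ Set.Icc 1 (m + 1) ×ˢ Set.Icc 1 (n + 1) :=
    ⟨Finset.mem_Icc.1 hs, Finset.mem_Icc.1 ht⟩
  congr 1
  exact propext ⟨h.le_of_le hξ hη hst hp, h.symm.le_of_le hη hξ hst hp⟩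

theorem SameSide.rankPair_eq {m n : ℕ} {ξ η : ℝ} (hξ : AvoidsFractions m n ξ)
    (hη : AvoidsFractions m n η) (h : SameSide m n ξ η) :
    rankPair (m + 1) (n + 1) ξ = rankPair (m + 1) (n + 1) η := by
  simp only [rankPair]
  rw [h.rankTable_eq hξ hη (by simp), h.rankTable_eq hξ hη (by simp)]

theorem AvoidsFractions.injOn_rankTable {m n : ℕ} {ξ : ℝ} (h : AvoidsFractions m n ξ) :
    Set.InjOn (rankTable (m + 1) (n + 1) ξ) (Set.Icc 1 (m + 1) ×ˢ Set.Icc 1 (n + 1)) := by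
  have aux : ∀ s t i j : ℕ, s ∈ Set.Icc 1 (m + 1) → t ∈ Set.Icc 1 (n + 1) →
      i ∈ Set.Icc 1 (m + 1) → j ∈ Set.Icc 1 (n + 1) → s < i →
      (s : ℝ) + t * ξ = i + j * ξ → False := by
    intro s t i j hs ht hi hj hsi heq
    have h1 : (s : ℝ) < i := by exact_mod_cast hsi
    have hjt : j < t := by
      by_contra! hc
      have h2 : (t : ℝ) ≤ j := by exact_mod_cast hc
      nlinarith [h.1]
    simp only [Set.mem_Icc] at hs ht hi hj
    refine h.2 (i - s) ⟨by omega, by omega⟩ (t - j) ⟨by omega, by omega⟩ ?_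
    rw [Nat.cast_sub hsi.le, Nat.cast_sub hjt.le]
    linarith
  rintro ⟨s, t⟩ hp ⟨i, j⟩ hq heq
  have heq' : (s : ℝ) + t * ξ = i + j * ξ :=
    le_antisymm ((rankTable_le_iff hp).1 heq.le) ((rankTable_le_iff hq).1 heq.ge)
  rcases lt_trichotomy s i with hsi | rfl | hsi
  · exact (aux s t i j hp.1 hp.2 hq.1 hq.2 hsi heq').elim
  · have : (t : ℝ) * ξ = j * ξ := by linarith
    have := mul_right_cancel₀ h.1.ne' this
    simpa using this
  · exact (aux i j s t hq.1 hq.2 hp.1 hp.2 hsi heq'.symm).elim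

theorem avoidsFractions_of_injOn {m n : ℕ} {ξ : ℝ} (hξ : 0 < ξ)
    (h : Set.InjOn (rankTable (m + 1) (n + 1) ξ) (Set.Icc 1 (m + 1) ×ˢ Set.Icc 1 (n + 1))) :
    AvoidsFractions m n ξ := by
  refine ⟨hξ, fun p hp q hq hpq => ?_⟩
  simp only [Set.mem_Icc] at hp hq
  have h1 : (p + 1, 1) ∈ Set.Icc 1 (m + 1) ×ˢ Set.Icc 1 (n + 1) := by simp; omega
  have h2 : (1, q + 1) ∈ Set.Icc 1 (m + 1) ×ˢ Set.Icc 1 (n + 1) := by simp; omega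
  have := h h1 h2 (le_antisymm ((rankTable_le_iff h1).2 (by push_cast; linarith))
    ((rankTable_le_iff h2).2 (by push_cast; linarith)))
  simp at this
  omega

theorem rankPair_mem_youngPairs {m n : ℕ} {ξ : ℝ} (h : AvoidsFractions m n ξ) :
    rankPair (m + 1) (n + 1) ξ ∈ youngPairs (m + 1) (n + 1) :=
  ⟨rankTable (m + 1) (n + 1) ξ, ⟨⟨ξ, h.1, Set.eqOn_refl _ _⟩, h.injOn_rankTable⟩, rfl⟩

theorem exists_rankPair_of_mem_youngPairs {m n : ℕ} {x : TerminalPair}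
    (hx : x ∈ youngPairs (m + 1) (n + 1)) :
    ∃ ξ, AvoidsFractions m n ξ ∧ x = rankPair (m + 1) (n + 1) ξ := by
  obtain ⟨θ, ⟨⟨ξ, hξ, heq⟩, hinj⟩, rfl⟩ := hx
  refine ⟨ξ, avoidsFractions_of_injOn hξ (heq.injOn_iff.1 hinj), ?_⟩
  rw [rankPair, heq (by simp), heq (by simp)]

/-- The terminal pair of a rank table determines on which side of each fraction its parameter
lies. -/
theorem sameSide_of_rankPair_eq {m n : ℕ} {ξ η : ℝ} (hξ : AvoidsFractions m n ξ)
    (hη : AvoidsFractions m n η) (h : rankPair (m + 1) (n + 1) ξ = rankPair (m + 1) (n + 1) η) :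
    SameSide m n ξ η := by
  induction hk : m + n generalizing m n with
  | zero => exact fun p hp => by simp only [Set.mem_Icc] at hp; omega
  | succ k ih =>
    rcases Nat.eq_zero_or_pos m with rfl | hm
    · exact fun p hp => by simp only [Set.mem_Icc] at hp; omega
    rcases Nat.eq_zero_or_pos n with rfl | hn
    · exact fun p _ q hq => by simp only [Set.mem_Icc] at hq; omega
    have hm0 : (0 : ℝ) < m := by exact_mod_cast hm
    have hn0 : (0 : ℝ) < n := by exact_mod_cast hn
    have side : ∀ ζ, AvoidsFractions m n ζ →
        ((rankPair (m + 1) (n + 1) ζ).t < (rankPair (m + 1) (n + 1) ζ).s ↔ n * ζ < m) := by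
      intro ζ hζ
      constructor
      · intro hlt
        by_contra! hc
        have hc' := lt_of_le_of_ne hc (hζ.2 m ⟨hm, le_rfl⟩ n ⟨hn, le_rfl⟩)
        exact (rankPair_lt_of_lt_mul (by omega) (by push_cast; linarith)).asymm hlt
      · intro hlt
        exact rankPair_lt_of_mul_lt (by omega) (by push_cast; linarith)
    by_cases hlt : n * ξ < m
    · have hlt' : n * η < m := (side η hη).1 (h ▸ (side ξ hξ).2 hlt)
      obtain ⟨m, rfl⟩ : ∃ m', m = m' + 1 := ⟨m - 1, by omega⟩
      have hrec : SameSide m n ξ η := by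
        refine ih (hξ.mono (by omega) le_rfl) (hη.mono (by omega) le_rfl) ?_ (by omega)
        rw [← diffU_rankPair_of_mul_lt (by omega) hξ.1 (by push_cast at *; linarith), h,
          diffU_rankPair_of_mul_lt (by omega) hη.1 (by push_cast at *; linarith)]
      -- The only fractions not covered by the recursion are `(m + 1) / q` with `q ≤ n`; they are at
      -- least `(m + 1) / n`, hence above both parameters.
      intro p hp q hq
      rcases Nat.lt_or_ge m p with hpm | hpm
      · obtain rfl : p = m + 1 := le_antisymm hp.2 hpm
        have hqn : (q : ℝ) ≤ n := by exact_mod_cast hq.2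
        exact iff_of_false (by nlinarith [hξ.1]) (by nlinarith [hη.1])
      · exact hrec p ⟨hp.1, hpm⟩ q hq
    · have hlt' : ¬ n * η < m := fun hc => hlt ((side ξ hξ).1 (h ▸ (side η hη).2 hc))
      have hgt := lt_of_le_of_ne (not_lt.1 hlt) (hξ.2 m ⟨hm, le_rfl⟩ n ⟨hn, le_rfl⟩)
      have hgt' := lt_of_le_of_ne (not_lt.1 hlt') (hη.2 m ⟨hm, le_rfl⟩ n ⟨hn, le_rfl⟩)
      obtain ⟨n, rfl⟩ : ∃ n', n = n' + 1 := ⟨n - 1, by omega⟩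
      have hrec : SameSide m n ξ η := by
        refine ih (hξ.mono le_rfl (by omega)) (hη.mono le_rfl (by omega)) ?_ (by omega)
        rw [← diffU_rankPair_of_lt_mul (by omega) hξ.1 (by push_cast at *; linarith), h,
          diffU_rankPair_of_lt_mul (by omega) hη.1 (by push_cast at *; linarith)]
      intro p hp q hq
      rcases Nat.lt_or_ge n q with hqn | hqn
      · obtain rfl : q = n + 1 := le_antisymm hq.2 hqn
        have hpm : (p : ℝ) ≤ m := by exact_mod_cast hp.2
        exact iff_of_true (by linarith) (by linarith)
      · exact hrec p hp q ⟨hq.1, hqn⟩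

/-! ### Extending rank tables -/

/-- If a fraction `p / q` below `ξ` is at least `m / n`, then each of the rows `2, …, n + 1` of the
grid contains a point between `(m, 1)` and `(1, n + 1)`, and one of the rows contains two. -/
theorem rankTable_add_le_of_fraction {m n p q : ℕ} {ξ : ℝ} (hξ : 0 < ξ) (hp : 1 ≤ p) (hpm : p < m)
    (hq : 1 ≤ q) (hqn : q ≤ n) (hlt : (p : ℝ) < q * ξ) (hle : m * q ≤ p * n) :
    rankTable m (n + 1) ξ (m, 1) + ((n + 1 : ℕ) : ℤ) ≤ rankTable m (n + 1) ξ (1, n + 1) := by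
  have hqn' : q < n := by
    rcases hqn.lt_or_eq with h | rfl
    · exact h
    · nlinarith
  have hp0 : (1 : ℝ) ≤ p := by exact_mod_cast hp
  have hpm0 : (p : ℝ) + 1 ≤ m := by exact_mod_cast hpm
  have hq0 : (1 : ℝ) ≤ q := by exact_mod_cast hq
  have hqn0 : (q : ℝ) + 1 ≤ n := by exact_mod_cast hqn'
  have hle0 : (m : ℝ) * q ≤ p * n := by exact_mod_cast hle
  have hm : (m : ℝ) < n * ξ := by
    have : (q : ℝ) * m < q * (n * ξ) := by nlinarith
    exact lt_of_mul_lt_mul_left this (by linarith)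
  -- Since `p / q` is at least `m / n`, the fraction `(m - p) / (n - q)` is at most `p / q`, hence
  -- below `ξ`.
  have hmp : (m : ℝ) - p < (n - q) * ξ := by
    have : (q : ℝ) * (m - p) < q * ((n - q) * ξ) := by nlinarith
    exact lt_of_mul_lt_mul_left this (by linarith)
  -- The exceptional row `n + 1 - q` is not row `1`, as `q < n`. Its two gained points have first
  -- coordinates `p` and `p + 1`: `hmp` puts both above `(m, 1)`, and `p < q * ξ` puts both below
  -- `(1, n + 1)`.
  have hrow : ∀ t ∈ Finset.Icc 1 (n + 1),
      (((Finset.Icc 1 m).filter fun s : ℕ =>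
        (s : ℝ) + (t : ℝ) * ξ ≤ (m : ℝ) + ((1 : ℕ) : ℝ) * ξ).card : ℤ) +
        (1 - (if t = 1 then 1 else 0) + if t = n + 1 - q then 1 else 0) ≤
      (((Finset.Icc 1 m).filter fun s : ℕ =>
        (s : ℝ) + (t : ℝ) * ξ ≤ ((1 : ℕ) : ℝ) + ((n + 1 : ℕ) : ℝ) * ξ).card : ℤ) := by
    intro t ht
    obtain ⟨ht1, htn⟩ := Finset.mem_Icc.1 ht
    have htn0 : (t : ℝ) ≤ n + 1 := by exact_mod_cast htn
    set A := (Finset.Icc 1 m).filter fun s : ℕ =>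
        (s : ℝ) + (t : ℝ) * ξ ≤ (m : ℝ) + ((1 : ℕ) : ℝ) * ξ with hA
    set B := (Finset.Icc 1 m).filter fun s : ℕ =>
        (s : ℝ) + (t : ℝ) * ξ ≤ ((1 : ℕ) : ℝ) + ((n + 1 : ℕ) : ℝ) * ξ with hB
    have hAB : A ⊆ B := Finset.monotone_filter_right _ fun s _ hs => hs.trans (by push_cast; linarith)
    rcases eq_or_ne t (n + 1 - q) with htq | htq
    · have htq0 : (t : ℝ) = n + 1 - q := by
        rw [htq, Nat.cast_sub (by omega)]; push_cast; ring
      have h1 : p ∉ A := by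
        simp only [hA, Finset.mem_filter, not_and, not_le, htq0]
        intro _
        push_cast
        linarith
      have h2 : p + 1 ∉ A := by
        simp only [hA, Finset.mem_filter, not_and, not_le, htq0]
        intro _
        push_cast
        linarith
      have h3 : p + 1 ∈ B := by
        simp only [hB, Finset.mem_filter, Finset.mem_Icc, htq0]
        refine ⟨by omega, ?_⟩
        push_cast
        linarith
      have h4 : p ∈ B := by
        simp only [hB, Finset.mem_filter, Finset.mem_Icc, htq0]
        refine ⟨by omega, ?_⟩
        push_cast
        linarith
      have := Finset.card_le_card (s := insert p (insert (p + 1) A)) (t := B)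
        (Finset.insert_subset h4 (Finset.insert_subset h3 hAB))
      rw [Finset.card_insert_of_notMem (by simp [h1]), Finset.card_insert_of_notMem h2] at this
      rw [if_neg (by omega), if_pos htq]
      omega
    · rw [if_neg htq]
      rcases eq_or_ne t 1 with rfl | ht1'
      · have := Finset.card_le_card hAB
        simp only [if_true]
        omega
      · have ht2 : (2 : ℝ) ≤ t := by exact_mod_cast (show 2 ≤ t by omega)
        -- By `hm` the window from `m + ξ` to `1 + (n + 1) * ξ` is longer than `1`, so the largest
        -- integer fitting under its top works, capped at `m`.
        obtain ⟨s, hs1, hsm, hs, hs'⟩ : ∃ s : ℕ, 1 ≤ s ∧ s ≤ m ∧ m + ξ < s + t * ξ ∧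
            s + t * ξ ≤ 1 + (n + 1) * ξ := by
          have hy : (0 : ℝ) ≤ 1 + (n + 1 - t) * ξ := by nlinarith
          rcases le_or_gt (m : ℝ) (1 + (n + 1 - t) * ξ) with hmy | hmy
          · exact ⟨m, by omega, le_rfl, by nlinarith, by linarith⟩
          · refine ⟨⌊1 + (n + 1 - t) * ξ⌋₊, ?_, ?_, ?_, ?_⟩
            · exact Nat.le_floor (by push_cast; nlinarith)
            · exact ((Nat.floor_lt hy).2 hmy).le
            · have := Nat.lt_floor_add_one (1 + (n + 1 - t) * ξ)
              linarith
            · have := Nat.floor_le hy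
              linarith
        have h1 : s ∉ A := by
          simp only [hA, Finset.mem_filter, not_and, not_le]
          intro _
          push_cast
          linarith
        have h2 : s ∈ B := by
          simp only [hB, Finset.mem_filter, Finset.mem_Icc]
          refine ⟨⟨hs1, hsm⟩, ?_⟩
          push_cast
          linarith
        have := Finset.card_le_card (Finset.insert_subset h2 hAB)
        rw [Finset.card_insert_of_notMem h1] at this
        rw [if_neg ht1']
        omega
  have hsum := Finset.sum_le_sum hrow
  rw [Finset.sum_add_distrib, Finset.sum_add_distrib, Finset.sum_sub_distrib,
    Finset.sum_ite_eq', Finset.sum_ite_eq', if_pos (by simp),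
    if_pos (by simp only [Finset.mem_Icc]; omega)] at hsum
  rw [rankTable_eq_sum_rows, rankTable_eq_sum_rows]
  refine le_trans (le_of_eq ?_) hsum
  simp

/-- By the preceding count, every fraction below `ξ` is also below `(m + 1) / n`. Thus `η` can be
taken just below the minimum of `ξ` and `(m + 1) / n` without crossing any of them. Irrationality
keeps `η` usable for grids of every size. -/
theorem exists_irrational_sameSide {m n : ℕ} {ξ : ℝ} (hξ : 0 < ξ)
    (h : (rankPair (m + 1) (n + 1) ξ).t < (rankPair (m + 1) (n + 1) ξ).s + ((n + 1 : ℕ) : ℤ)) :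
    ∃ η, Irrational η ∧ 0 < η ∧ n * η < m + 1 ∧ SameSide m n ξ η := by
  have hfrac : ∀ p ∈ Set.Icc 1 m, ∀ q ∈ Set.Icc 1 n, (p : ℝ) < q * ξ → p * n < (m + 1) * q := by
    intro p hp q hq hpq
    by_contra! hc
    have := rankTable_add_le_of_fraction (m := m + 1) hξ hp.1 (Nat.lt_succ_of_le hp.2) hq.1 hq.2 hpq hc
    simp only [rankPair] at h
    omega
  obtain ⟨M, hM0, hMξ, hMn, hM⟩ : ∃ M : ℝ, 0 < M ∧ M ≤ ξ ∧ n * M ≤ m + 1 ∧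
      ∀ p ∈ Set.Icc 1 m, ∀ q ∈ Set.Icc 1 n, (p : ℝ) < q * ξ → (p : ℝ) < q * M := by
    rcases Nat.eq_zero_or_pos n with rfl | hn
    · refine ⟨ξ, hξ, le_rfl, by simp; positivity, fun p _ q hq => ?_⟩
      simp only [Set.mem_Icc] at hq
      omega
    · have hn0 : (0 : ℝ) < n := by exact_mod_cast hn
      refine ⟨min ξ ((m + 1) / n), lt_min hξ (by positivity), min_le_left _ _, ?_, ?_⟩
      · rw [← le_div_iff₀' hn0]
        exact min_le_right _ _
      · intro p hp q hq hpq
        have hq0 : (0 : ℝ) < q := by exact_mod_cast hq.1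
        rw [← div_lt_iff₀' hq0] at hpq ⊢
        refine lt_min hpq ?_
        rw [div_lt_div_iff₀ hq0 hn0]
        exact_mod_cast hfrac p hp q hq (by rwa [← div_lt_iff₀' hq0])
  have hev : ∀ᶠ η in nhdsWithin M (Set.Iio M), 0 < η ∧
      ∀ p ∈ Set.Icc 1 m, ∀ q ∈ Set.Icc 1 n, (p : ℝ) < q * ξ → (p : ℝ) < q * η := by
    refine Filter.Eventually.filter_mono nhdsWithin_le_nhds ?_
    refine (lt_mem_nhds hM0).and ?_
    rw [(Set.finite_Icc 1 m).eventually_all]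
    intro p hp
    rw [(Set.finite_Icc 1 n).eventually_all]
    intro q hq
    rw [Filter.eventually_imp_distrib_left]
    intro hpq
    have : Filter.Tendsto (fun η : ℝ => q * η) (nhds M) (nhds (q * M)) :=
      (continuous_const.mul continuous_id).tendsto M
    exact this.eventually (lt_mem_nhds (hM p hp q hq hpq))
  obtain ⟨l, hl, hIoo⟩ := mem_nhdsLT_iff_exists_Ioo_subset.1 hev
  obtain ⟨η, hirr, h1, h2⟩ := exists_irrational_btwn (Set.mem_Iio.1 hl)
  obtain ⟨hη0, hη⟩ := hIoo ⟨h1, h2⟩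
  refine ⟨η, hirr, hη0, ?_, fun p hp q hq => ⟨hη p hp q hq, fun hpq => hpq.trans_le ?_⟩⟩
  · rcases Nat.eq_zero_or_pos n with rfl | hn
    · simp; positivity
    · have hn0 : (0 : ℝ) < n := by exact_mod_cast hn
      nlinarith
  · exact mul_le_mul_of_nonneg_left (h2.le.trans hMξ) q.cast_nonneg

theorem exists_irrational_rankPair_succ_left {m n : ℕ} (hm : 1 ≤ m) (hn : 1 ≤ n) {s t : ℤ}
    (h : ∃ ξ, Irrational ξ ∧ 0 < ξ ∧ rankPair m n ξ = ⟨s, t, m, n⟩) (hst : t < s + n) :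
    ∃ ξ, Irrational ξ ∧ 0 < ξ ∧ rankPair (m + 1) n ξ = ⟨s + n, t, m + 1, n⟩ := by
  obtain ⟨ξ, hirr, hξ, heq⟩ := h
  obtain ⟨m, rfl⟩ : ∃ m', m = m' + 1 := ⟨m - 1, by omega⟩
  obtain ⟨n, rfl⟩ : ∃ n', n = n' + 1 := ⟨n - 1, by omega⟩
  obtain ⟨η, hirr', hη, hlt, hside⟩ := exists_irrational_sameSide (m := m) (n := n) hξ
    (by rw [heq]; exact hst)
  refine ⟨η, hirr', hη, ?_⟩
  rw [rankPair_succ_left hη (by push_cast; linarith), ← hside.rankPair_eq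
    (hirr.avoidsFractions hξ m n) (hirr'.avoidsFractions hη m n), heq]

/-! ### L-shapes of difference equation type -/

theorem mem_lShape {m n : ℕ} {p : ℕ × ℕ} :
    p ∈ lShape m n ↔ ((1 ≤ p.1 ∧ p.1 ≤ m) ∧ p.2 = 1) ∨ (p.1 = 1 ∧ 1 ≤ p.2 ∧ p.2 ≤ n) := by
  simp [lShape]

theorem swap_mem_lShape {m n : ℕ} {p : ℕ × ℕ} : p.swap ∈ lShape n m ↔ p ∈ lShape m n := by
  simp only [mem_lShape, Prod.fst_swap, Prod.snd_swap]
  tauto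

theorem IsDiffLShape.swap {m n : ℕ} {f : ℕ × ℕ → ℤ} (h : IsDiffLShape m n f) :
    IsDiffLShape n m (f ∘ Prod.swap) := by
  obtain ⟨hmaps, hinj, hdiff, hone⟩ := h
  refine ⟨fun p hp => ?_, fun p hp q hq hpq => ?_, ⟨hdiff.2, hdiff.1⟩, hone⟩
  · rw [mul_comm]
    exact hmaps (swap_mem_lShape.2 hp)
  · exact Prod.swap_injective (hinj (swap_mem_lShape.2 hp) (swap_mem_lShape.2 hq) hpq)

theorem youngPairs_subset_diffPairs {m n : ℕ} :
    youngPairs (m + 1) (n + 1) ⊆ diffPairs (m + 1) (n + 1) := by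
  intro x hx
  obtain ⟨ξ, hξ, rfl⟩ := exists_rankPair_of_mem_youngPairs hx
  have hsub : lShape (m + 1) (n + 1) ⊆ Set.Icc 1 (m + 1) ×ˢ Set.Icc 1 (n + 1) := by
    intro p hp
    rw [mem_lShape] at hp
    simp only [Set.mem_prod, Set.mem_Icc]
    omega
  exact ⟨rankTable (m + 1) (n + 1) ξ, ⟨fun p hp => rankTable_mem_Icc (hsub hp),
    hξ.injOn_rankTable.mono hsub, rankTable_diffEq _ _ hξ.1,
    rankTable_one_one (by omega) (by omega) hξ.1⟩, rfl⟩

theorem DiffEq.swap {m n : ℕ} {f : ℕ × ℕ → ℤ} (h : DiffEq m n f) : DiffEq n m (f ∘ Prod.swap) :=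
  ⟨h.2, h.1⟩

theorem DiffEq.le_of_le {m n : ℕ} {f : ℕ × ℕ → ℤ} (h : DiffEq m n f) {i i' : ℕ} (hi : 1 ≤ i)
    (hii' : i ≤ i') (hi' : i' ≤ m) : f (i, 1) ≤ f (i', 1) := by
  induction i', hii' using Nat.le_induction with
  | base => rfl
  | succ k hk ih =>
    refine (ih (by omega)).trans (sub_nonneg.1 ?_)
    rw [h.1 k ⟨by omega, by omega⟩]
    exact Finset.sum_nonneg fun t _ => by split_ifs <;> simp

theorem DiffEq.le_add_mul {m n : ℕ} {f : ℕ × ℕ → ℤ} (h : DiffEq m n f) {i : ℕ} (hi : i < m) :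
    f (i + 1, 1) ≤ f (1, 1) + i * n := by
  induction i with
  | zero => simp
  | succ k ih =>
    have h1 := h.1 (k + 1) ⟨by omega, by omega⟩
    have h2 : (∑ t ∈ Finset.Icc 1 n, if f (1, t) ≤ f (k + 1 + 1, 1) then (1 : ℤ) else 0) ≤
        ∑ t ∈ Finset.Icc 1 n, 1 := Finset.sum_le_sum fun t _ => by split_ifs <;> simp
    simp only [Finset.sum_const, Nat.card_Icc, Nat.add_sub_cancel, mul_one,
      nsmul_eq_mul] at h2
    have h3 := ih (by omega)
    push_cast
    linarith

theorem IsDiffLShape.eq_add {m n : ℕ} {f : ℕ × ℕ → ℤ} (h : IsDiffLShape (m + 1) n f) (hm : 1 ≤ m)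
    (hlt : f (1, n) < f (m + 1, 1)) : f (m + 1, 1) = f (m, 1) + n := by
  rw [← sub_eq_iff_eq_add', h.2.2.1.1 m ⟨hm, le_rfl⟩, Finset.sum_congr rfl fun t ht => if_pos ?_]
  · simp
  · obtain ⟨ht1, htn⟩ := Finset.mem_Icc.1 ht
    exact (h.2.2.1.swap.le_of_le ht1 htn le_rfl).trans hlt.le

/-- The removed value exceeds the whole other arm, so it never counts in the equations of that arm.
The bound `m * n` holds on the shortened arm because its end drops by `n`, and on the other because
each of its steps is at most `m`. -/
theorem IsDiffLShape.restrict {m n : ℕ} {f : ℕ × ℕ → ℤ} (h : IsDiffLShape (m + 1) n f)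
    (hm : 1 ≤ m) (hn : 1 ≤ n) (hlt : f (1, n) < f (m + 1, 1)) : IsDiffLShape m n f := by
  have heq := h.eq_add hm hlt
  obtain ⟨hmaps, hinj, hdiff, hone⟩ := h
  have hsub : lShape m n ⊆ lShape (m + 1) n := by
    intro p
    rw [mem_lShape, mem_lShape]
    omega
  have hdiff' : DiffEq m n f := by
    refine ⟨fun i hi => hdiff.1 i ⟨hi.1, hi.2.trans (by omega)⟩, fun j hj => ?_⟩
    rw [hdiff.2 j hj, Finset.sum_Icc_succ_top (by omega), add_eq_left, if_neg]
    have h1 := hj.2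
    exact not_le.2 ((hdiff.swap.le_of_le (i := j + 1) (by omega) (by omega) le_rfl).trans_lt hlt)
  refine ⟨fun p hp => ⟨(hmaps (hsub hp)).1, ?_⟩, hinj.mono hsub, hdiff', hone⟩
  obtain ⟨i, j⟩ := p
  rcases mem_lShape.1 hp with ⟨⟨h1, h2⟩, h3⟩ | ⟨h1, h2, h3⟩
  · obtain rfl : j = 1 := h3
    have h4 := hdiff'.le_of_le h1 h2 le_rfl
    have h5 := (hmaps (mem_lShape.2 (Or.inl ⟨⟨by omega, le_rfl⟩, rfl⟩) :
      (m + 1, 1) ∈ lShape (m + 1) n)).2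
    push_cast at h5
    dsimp only at h4
    linarith
  · obtain rfl : i = 1 := h1
    obtain ⟨j, rfl⟩ : ∃ j', j = j' + 1 := ⟨j - 1, by dsimp only at h2; omega⟩
    have h4 := hdiff'.swap.le_add_mul (i := j) (by dsimp only at h3; omega)
    simp only [Function.comp_apply, Prod.swap_prod_mk, hone] at h4
    have h5 : ((j : ℤ) + 1) ≤ n := by exact_mod_cast h3
    have h6 : (1 : ℤ) ≤ m := by exact_mod_cast hm
    nlinarith

theorem exists_irrational_rankPair_swap {m n : ℕ} {s t : ℤ}
    (h : ∃ ξ, Irrational ξ ∧ 0 < ξ ∧ rankPair m n ξ = ⟨s, t, m, n⟩) :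
    ∃ ξ, Irrational ξ ∧ 0 < ξ ∧ rankPair n m ξ = ⟨t, s, n, m⟩ := by
  obtain ⟨ξ, hirr, hξ, heq⟩ := h
  exact ⟨ξ⁻¹, hirr.inv, inv_pos.2 hξ, by rw [rankPair_swap m n hξ, heq]; rfl⟩

/-- Induction on `m + n`, shortening the arm with the larger end; equal ends force `m = n = 1` by
injectivity. -/
theorem IsDiffLShape.exists_irrational {m n : ℕ} {f : ℕ × ℕ → ℤ} (h : IsDiffLShape m n f)
    (hm : 1 ≤ m) (hn : 1 ≤ n) :
    ∃ ξ, Irrational ξ ∧ 0 < ξ ∧ rankPair m n ξ = ⟨f (m, 1), f (1, n), m, n⟩ := by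
  induction hk : m + n using Nat.strong_induction_on generalizing m n f with
  | _ k ih =>
    have step : ∀ {m n : ℕ} {f : ℕ × ℕ → ℤ}, IsDiffLShape m n f → 1 ≤ m → 1 ≤ n → m + n = k →
        f (1, n) < f (m, 1) →
        ∃ ξ, Irrational ξ ∧ 0 < ξ ∧ rankPair m n ξ = ⟨f (m, 1), f (1, n), m, n⟩ := by
      intro m n f h hm hn hk hlt
      rcases hm.eq_or_lt with rfl | hm
      · exact (hlt.not_ge (h.2.2.1.swap.le_of_le le_rfl hn le_rfl)).elim
      obtain ⟨m, rfl⟩ : ∃ m', m = m' + 1 := ⟨m - 1, by omega⟩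
      have heq := h.eq_add (by omega) hlt
      rw [heq]
      exact exists_irrational_rankPair_succ_left (by omega) hn
        (ih _ (by omega) (h.restrict (by omega) hn hlt) (by omega) hn rfl) (heq ▸ hlt)
    rcases lt_trichotomy (f (m, 1)) (f (1, n)) with hlt | heq | hlt
    · exact exists_irrational_rankPair_swap (step h.swap hn hm (by omega) hlt)
    · have := h.2.1 (mem_lShape.2 (Or.inl ⟨⟨hm, le_rfl⟩, rfl⟩))
        (mem_lShape.2 (Or.inr ⟨rfl, hn, le_rfl⟩)) heq
      simp only [Prod.mk.injEq] at this
      obtain ⟨rfl, rfl⟩ := this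
      refine ⟨√2, irrational_sqrt_two, by positivity, ?_⟩
      rw [rankPair, rankTable_one_one le_rfl le_rfl (by positivity), h.2.2.2]
    · exact step h hm hn hk hlt

theorem youngPairs_eq_diffPairs {m n : ℕ} (hm : 1 ≤ m) (hn : 1 ≤ n) :
    youngPairs m n = diffPairs m n := by
  obtain ⟨m, rfl⟩ : ∃ m', m = m' + 1 := ⟨m - 1, by omega⟩
  obtain ⟨n, rfl⟩ : ∃ n', n = n' + 1 := ⟨n - 1, by omega⟩
  refine youngPairs_subset_diffPairs.antisymm ?_
  rintro x ⟨f, hf, rfl⟩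
  obtain ⟨ξ, hirr, hξ, heq⟩ := hf.exists_irrational hm hn
  rw [← heq]
  exact rankPair_mem_youngPairs (hirr.avoidsFractions hξ m n)

theorem youngLevel_eq_diffLevel (k : ℕ) : youngLevel k = diffLevel k := by
  ext x
  refine exists_congr fun m => exists_congr fun n => and_congr_right fun hm =>
    and_congr_right fun hn => and_congr_right fun _ => ?_
  rw [youngPairs_eq_diffPairs hm hn]

theorem youngLevel_two : youngLevel 2 = {⟨1, 1, 1, 1⟩} := by
  have hone : ∀ ξ : ℝ, 0 < ξ → rankPair 1 1 ξ = ⟨1, 1, 1, 1⟩ := fun ξ hξ => by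
    rw [rankPair, rankTable_one_one le_rfl le_rfl hξ]
  ext x
  constructor
  · rintro ⟨m, n, hm, hn, hmn, hx⟩
    obtain rfl : m = 1 := by omega
    obtain rfl : n = 1 := by omega
    obtain ⟨ξ, hξ, rfl⟩ := exists_rankPair_of_mem_youngPairs hx
    exact hone ξ hξ.1
  · rintro rfl
    refine ⟨1, 1, le_rfl, le_rfl, rfl, ?_⟩
    rw [← hone √2 (by positivity)]
    exact rankPair_mem_youngPairs (irrational_sqrt_two.avoidsFractions (by positivity) 0 0)

/-! ### Generalized Farey intervals and rank tables -/

theorem mem_fareySet {m n : ℕ} {c : EReal} : c ∈ fareySet m n ↔ c = 0 ∨ c = ⊤ ∨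
    ∃ p q : ℕ, 1 ≤ p ∧ p ≤ m ∧ 1 ≤ q ∧ q ≤ n ∧ c = (((p : ℝ) / (q : ℝ) : ℝ) : EReal) := by
  simp only [fareySet, Set.mem_union, Set.mem_insert_iff, Set.mem_singleton_iff, Set.mem_ofPred_eq,
    Set.mem_Icc, or_assoc, and_assoc, exists_and_left]

theorem finite_fareySet (m n : ℕ) : (fareySet m n).Finite := by
  refine (Set.toFinite _).union (((Set.finite_Icc 1 m).image2
    (fun p q : ℕ => (((p : ℝ) / (q : ℝ) : ℝ) : EReal)) (Set.finite_Icc 1 n)).subset ?_)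
  rintro c ⟨p, hp, q, hq, rfl⟩
  exact ⟨p, hp, q, hq, rfl⟩

theorem fareySet_mono {m n m' n' : ℕ} (hm : m ≤ m') (hn : n ≤ n') :
    fareySet m n ⊆ fareySet m' n' := by
  intro c
  rw [mem_fareySet, mem_fareySet]
  rintro (h | h | ⟨p, q, h1, h2, h3, h4, h⟩)
  · exact Or.inl h
  · exact Or.inr (Or.inl h)
  · exact Or.inr (Or.inr ⟨p, q, h1, h2.trans hm, h3, h4.trans hn, h⟩)

theorem zero_mem_fareySet (m n : ℕ) : 0 ∈ fareySet m n := mem_fareySet.2 (Or.inl rfl)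

theorem top_mem_fareySet (m n : ℕ) : ⊤ ∈ fareySet m n := mem_fareySet.2 (Or.inr (Or.inl rfl))

theorem nonneg_of_mem_fareySet {m n : ℕ} {c : EReal} (hc : c ∈ fareySet m n) : 0 ≤ c := by
  rcases mem_fareySet.1 hc with rfl | rfl | ⟨p, q, -, -, -, -, rfl⟩
  · exact le_rfl
  · exact le_top
  · exact EReal.coe_nonneg.2 (by positivity)

theorem coe_div_lt_coe {p q : ℕ} (hq : 1 ≤ q) {ξ : ℝ} :
    (((p : ℝ) / (q : ℝ) : ℝ) : EReal) < ξ ↔ (p : ℝ) < q * ξ := by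
  rw [EReal.coe_lt_coe_iff, div_lt_iff₀' (by exact_mod_cast hq)]

theorem coe_lt_coe_div {p q : ℕ} (hq : 1 ≤ q) {ξ : ℝ} :
    (ξ : EReal) < (((p : ℝ) / (q : ℝ) : ℝ) : EReal) ↔ q * ξ < (p : ℝ) := by
  rw [EReal.coe_lt_coe_iff, lt_div_iff₀' (by exact_mod_cast hq)]

theorem AvoidsFractions.notMem_fareySet {m n : ℕ} {ξ : ℝ} (h : AvoidsFractions m n ξ) :
    (ξ : EReal) ∉ fareySet m n := by
  rw [mem_fareySet]
  rintro (h' | h' | ⟨p, q, h1, h2, h3, h4, h'⟩)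
  · exact h.1.ne' (by exact_mod_cast h')
  · exact EReal.coe_ne_top _ h'
  · refine h.2 p ⟨h1, h2⟩ q ⟨h3, h4⟩ ?_
    rw [EReal.coe_eq_coe_iff] at h'
    have : (q : ℝ) ≠ 0 := by positivity
    rw [h']
    field_simp

theorem IsFareyInterval.avoidsFractions {m n : ℕ} {a b : EReal} (h : IsFareyInterval m n a b)
    {ξ : ℝ} (ha : a < ξ) (hb : ξ < b) : AvoidsFractions m n ξ := by
  refine ⟨by exact_mod_cast (nonneg_of_mem_fareySet h.1).trans_lt ha, fun p hp q hq hpq => ?_⟩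
  refine h.2.2.2 ξ (mem_fareySet.2 (Or.inr (Or.inr ⟨p, q, hp.1, hp.2, hq.1, hq.2, ?_⟩))) ⟨ha, hb⟩
  have : (q : ℝ) ≠ 0 := by
    have := hq.1
    positivity
  rw [hpq, mul_div_cancel_left₀ _ this]

theorem IsFareyInterval.sameSide {m n : ℕ} {a b : EReal} (h : IsFareyInterval m n a b) {ξ η : ℝ}
    (hξ : a < ξ ∧ ξ < b) (hη : a < η ∧ η < b) : SameSide m n ξ η := by
  have aux : ∀ p ∈ Set.Icc 1 m, ∀ q ∈ Set.Icc 1 n, ∀ ζ : ℝ, a < ζ → ζ < b →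
      ((p : ℝ) < q * ζ ↔ (((p : ℝ) / (q : ℝ) : ℝ) : EReal) ≤ a) := by
    intro p hp q hq ζ h1 h2
    rw [← coe_div_lt_coe hq.1]
    refine ⟨fun h3 => ?_, fun h3 => h3.trans_lt h1⟩
    by_contra! h4
    exact h.2.2.2 _ (mem_fareySet.2 (Or.inr (Or.inr ⟨p, q, hp.1, hp.2, hq.1, hq.2, rfl⟩)))
      ⟨h4, h3.trans h2⟩
  exact fun p hp q hq => (aux p hp q hq ξ hξ.1 hξ.2).trans (aux p hp q hq η hη.1 hη.2).symm

theorem SameSide.lt_coe_of_lt {m n : ℕ} {ξ η : ℝ} (h : SameSide m n ξ η) (hη : 0 < η) {c : EReal}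
    (hc : c ∈ fareySet m n) (hlt : c < ξ) : c < η := by
  rcases mem_fareySet.1 hc with rfl | rfl | ⟨p, q, h1, h2, h3, h4, rfl⟩
  · exact_mod_cast hη
  · exact (not_top_lt hlt).elim
  · rw [coe_div_lt_coe h3] at hlt ⊢
    exact (h p ⟨h1, h2⟩ q ⟨h3, h4⟩).1 hlt

/-- If either inequality failed, an endpoint of one interval would lie strictly inside the other.
Used in both directions, this gives injectivity of `suranyi`. -/
theorem SameSide.endpoints_le {m n : ℕ} {ξ η : ℝ} (h : SameSide m n ξ η)
    {a b a' b' : EReal} (hab : IsFareyInterval m n a b) (hab' : IsFareyInterval m n a' b')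
    (hξ : a < ξ ∧ ξ < b) (hη : a' < η ∧ η < b') : a ≤ a' ∧ b ≤ b' := by
  have hη' := hab'.avoidsFractions hη.1 hη.2
  have hξ' := hab.avoidsFractions hξ.1 hξ.2
  constructor
  · by_contra! hlt
    exact hab'.2.2.2 a hab.1 ⟨hlt, (h.lt_coe_of_lt hη'.1 hab.1 hξ.1).trans hη.2⟩
  · by_contra! hlt
    refine hab.2.2.2 b' hab'.2.1 ⟨?_, hlt⟩
    refine hξ.1.trans (lt_of_le_of_ne (not_lt.1 fun hlt' => ?_) ?_)
    · exact (h.lt_coe_of_lt hη'.1 hab'.2.1 hlt').not_gt hη.2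
    · rintro heq
      exact hξ'.notMem_fareySet (heq ▸ hab'.2.1)

theorem AvoidsFractions.exists_isFareyInterval {m n : ℕ} {ξ : ℝ} (h : AvoidsFractions m n ξ) :
    ∃ a b, IsFareyInterval m n a b ∧ a < ξ ∧ ξ < b := by
  have ha := Set.Nonempty.csSup_mem (s := {c | c ∈ fareySet m n ∧ c < ξ})
    ⟨0, zero_mem_fareySet m n, by exact_mod_cast h.1⟩
    ((finite_fareySet m n).subset fun c hc => hc.1)
  have hb := Set.Nonempty.csInf_mem (s := {c | c ∈ fareySet m n ∧ ξ < c})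
    ⟨⊤, top_mem_fareySet m n, EReal.coe_lt_top ξ⟩
    ((finite_fareySet m n).subset fun c hc => hc.1)
  refine ⟨_, _, ⟨ha.1, hb.1, ha.2.trans hb.2, fun c hc hlt => ?_⟩, ha.2, hb.2⟩
  rcases lt_trichotomy c ξ with hcξ | rfl | hcξ
  · exact hlt.1.not_ge (le_sSup ⟨hc, hcξ⟩)
  · exact h.notMem_fareySet hc
  · exact hlt.2.not_ge (sInf_le ⟨hc, hcξ⟩)

theorem mem_fareyLevel {k : ℕ} {z : TaggedInterval} :
    z ∈ fareyLevel k ↔ z.m + z.n = k ∧ IsFareyInterval z.m z.n z.a z.b := by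
  constructor
  · rintro ⟨m, n, hk, rfl, rfl, h⟩
    exact ⟨hk, h⟩
  · rintro ⟨hk, h⟩
    exact ⟨_, _, hk, rfl, rfl, h⟩

theorem suranyi_eq_rankPair {z : TaggedInterval} (h : IsFareyInterval z.m z.n z.a z.b) {ξ : ℝ}
    (ha : z.a < ξ) (hb : ξ < z.b) : suranyi z = rankPair (z.m + 1) (z.n + 1) ξ := by
  have hε : z.a < (Classical.epsilon fun ξ : ℝ => z.a < (ξ : EReal) ∧ (ξ : EReal) < z.b : ℝ) ∧
      (Classical.epsilon fun ξ : ℝ => z.a < (ξ : EReal) ∧ (ξ : EReal) < z.b : ℝ) < z.b :=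
    Classical.epsilon_spec (p := fun ξ : ℝ => z.a < (ξ : EReal) ∧ (ξ : EReal) < z.b) ⟨ξ, ha, hb⟩
  exact (h.sameSide hε ⟨ha, hb⟩).rankPair_eq (h.avoidsFractions hε.1 hε.2)
    (h.avoidsFractions ha hb)

theorem bijOn_suranyi (k : ℕ) : Set.BijOn suranyi (fareyLevel k) (youngLevel (k + 2)) := by
  refine ⟨fun z hz => ?_, fun z hz w hw heq => ?_, ?_⟩
  · obtain ⟨hk, hz⟩ := mem_fareyLevel.1 hz
    obtain ⟨ξ, ha, hb⟩ := EReal.lt_iff_exists_real_btwn.1 hz.2.2.1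
    rw [suranyi_eq_rankPair hz ha hb]
    exact ⟨z.m + 1, z.n + 1, by omega, by omega, by omega,
      rankPair_mem_youngPairs (hz.avoidsFractions ha hb)⟩
  · obtain ⟨-, hz⟩ := mem_fareyLevel.1 hz
    obtain ⟨-, hw⟩ := mem_fareyLevel.1 hw
    obtain ⟨ξ, ha, hb⟩ := EReal.lt_iff_exists_real_btwn.1 hz.2.2.1
    obtain ⟨η, ha', hb'⟩ := EReal.lt_iff_exists_real_btwn.1 hw.2.2.1
    rw [suranyi_eq_rankPair hz ha hb, suranyi_eq_rankPair hw ha' hb'] at heq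
    obtain ⟨a, b, m, n⟩ := z
    obtain ⟨a', b', m', n'⟩ := w
    dsimp only at *
    obtain rfl : m = m' := by simpa [rankPair] using congrArg TerminalPair.m heq
    obtain rfl : n = n' := by simpa [rankPair] using congrArg TerminalPair.n heq
    have hside := sameSide_of_rankPair_eq (hz.avoidsFractions ha hb)
      (hw.avoidsFractions ha' hb') heq
    obtain ⟨h1, h2⟩ := hside.endpoints_le hz hw ⟨ha, hb⟩ ⟨ha', hb'⟩
    obtain ⟨h3, h4⟩ := hside.symm.endpoints_le hw hz ⟨ha', hb'⟩ ⟨ha, hb⟩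
    rw [h1.antisymm h3, h2.antisymm h4]
  · rintro x ⟨m, n, hm, hn, hk, hx⟩
    obtain ⟨m, rfl⟩ : ∃ m', m = m' + 1 := ⟨m - 1, by omega⟩
    obtain ⟨n, rfl⟩ : ∃ n', n = n' + 1 := ⟨n - 1, by omega⟩
    obtain ⟨ξ, hξ, rfl⟩ := exists_rankPair_of_mem_youngPairs hx
    obtain ⟨a, b, hab, ha, hb⟩ := hξ.exists_isFareyInterval
    exact ⟨⟨a, b, m, n⟩, mem_fareyLevel.2 ⟨by dsimp only; omega, hab⟩,
      suranyi_eq_rankPair (z := ⟨a, b, m, n⟩) hab ha hb⟩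

/-! ### The inter-level maps -/

theorem coe_div_le_coe_div {p q m n : ℕ} (hq : 1 ≤ q) (hn : 1 ≤ n) :
    (((p : ℝ) / (q : ℝ) : ℝ) : EReal) ≤ (((m : ℝ) / (n : ℝ) : ℝ) : EReal) ↔
      p * n ≤ m * q := by
  rw [EReal.coe_le_coe_iff, div_le_div_iff₀ (by exact_mod_cast hq) (by exact_mod_cast hn)]
  exact_mod_cast Iff.rfl

/-- A fraction with numerator `m` and denominator at most `n` is at least `m / n`, so lowering `m`
loses nothing below `m / n`. -/
theorem mem_fareySet_of_lt_div {m n : ℕ} (hn : 1 ≤ n) {c : EReal} (hc : c ∈ fareySet m n)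
    (hlt : c < (((m : ℝ) / (n : ℝ) : ℝ) : EReal)) : c ∈ fareySet (m - 1) n := by
  rcases mem_fareySet.1 hc with rfl | rfl | ⟨p, q, h1, h2, h3, h4, rfl⟩
  · exact zero_mem_fareySet _ _
  · exact top_mem_fareySet _ _
  · refine mem_fareySet.2 (Or.inr (Or.inr ⟨p, q, h1, ?_, h3, h4, rfl⟩))
    by_contra! hp
    obtain rfl : p = m := by omega
    exact hlt.not_ge ((coe_div_le_coe_div hn h3).2 (Nat.mul_le_mul_left _ h4))

theorem mem_fareySet_of_div_lt {m n : ℕ} (hn : 1 ≤ n) {c : EReal} (hc : c ∈ fareySet m n)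
    (hlt : (((m : ℝ) / (n : ℝ) : ℝ) : EReal) < c) : c ∈ fareySet m (n - 1) := by
  rcases mem_fareySet.1 hc with rfl | rfl | ⟨p, q, h1, h2, h3, h4, rfl⟩
  · exact zero_mem_fareySet _ _
  · exact top_mem_fareySet _ _
  · refine mem_fareySet.2 (Or.inr (Or.inr ⟨p, q, h1, h2, h3, ?_, rfl⟩))
    by_contra! hq
    obtain rfl : q = n := by omega
    exact hlt.not_ge ((coe_div_le_coe_div h3 hn).2 (Nat.mul_le_mul_right _ h2))

theorem isFareyInterval_zero_top {m n : ℕ} (h : m = 0 ∨ n = 0) : IsFareyInterval m n 0 ⊤ := by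
  refine ⟨zero_mem_fareySet m n, top_mem_fareySet m n, EReal.zero_lt_top, fun c hc hlt => ?_⟩
  rcases mem_fareySet.1 hc with rfl | rfl | ⟨p, q, h1, h2, h3, h4, rfl⟩
  · exact lt_irrefl _ hlt.1
  · exact lt_irrefl _ hlt.2
  · omega

/-- All that later arguments need of `fareyV`: the new interval contains the old one, and the axis
shortened is the one dictated by the side of `m / n`. An empty axis fits the same strict
inequalities. -/
theorem fareyV_spec {z : TaggedInterval} (hz : IsFareyInterval z.m z.n z.a z.b)
    (hpos : 1 ≤ z.m + z.n) :
    IsFareyInterval (fareyV z).m (fareyV z).n (fareyV z).a (fareyV z).b ∧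
      (fareyV z).a ≤ z.a ∧ z.b ≤ (fareyV z).b ∧
      (((fareyV z).m + 1 = z.m ∧ (fareyV z).n = z.n ∧
          ∀ ξ : ℝ, z.a < ξ → ξ < z.b → z.n * ξ < z.m) ∨
        ((fareyV z).m = z.m ∧ (fareyV z).n + 1 = z.n ∧
          ∀ ξ : ℝ, z.a < ξ → ξ < z.b → z.m < z.n * ξ)) := by
  obtain ⟨a, b, m, n⟩ := z
  obtain ⟨ha, hb, hab, hadj⟩ := hz
  dsimp only at *
  have ha0 := nonneg_of_mem_fareySet ha
  rcases Nat.eq_zero_or_pos m with rfl | hm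
  · have hV : fareyV ⟨a, b, 0, n⟩ = ⟨0, ⊤, 0, n - 1⟩ := by simp [fareyV]
    rw [hV]
    refine ⟨isFareyInterval_zero_top (Or.inl rfl), ha0, le_top,
      Or.inr ⟨rfl, by dsimp only; omega, fun ξ h1 _ => ?_⟩⟩
    have h2 : (0 : ℝ) < ξ := by exact_mod_cast ha0.trans_lt h1
    have h3 : (0 : ℝ) < n := by exact_mod_cast (show 0 < n by omega)
    simpa using mul_pos h3 h2
  rcases Nat.eq_zero_or_pos n with rfl | hn
  · have hV : fareyV ⟨a, b, m, 0⟩ = ⟨0, ⊤, m - 1, 0⟩ := by simp [fareyV, hm.ne']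
    rw [hV]
    refine ⟨isFareyInterval_zero_top (Or.inr rfl), ha0, le_top,
      Or.inl ⟨by dsimp only; omega, rfl, fun ξ _ _ => ?_⟩⟩
    simpa using hm
  set r : EReal := (((m : ℝ) / (n : ℝ) : ℝ) : EReal) with hr
  have hrmem : r ∈ fareySet m n :=
    mem_fareySet.2 (Or.inr (Or.inr ⟨m, n, hm, le_rfl, hn, le_rfl, rfl⟩))
  have hleft : b ≤ r → ∀ ξ : ℝ, a < ξ → ξ < b → n * ξ < m := fun h ξ _ h2 =>
    (coe_lt_coe_div hn).1 (h2.trans_le h)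
  have hright : r ≤ a → ∀ ξ : ℝ, a < ξ → ξ < b → m < n * ξ := fun h ξ h1 _ =>
    (coe_div_lt_coe hn).1 (h.trans_lt h1)
  have hsubm := fareySet_mono (Nat.sub_le m 1) (le_refl n)
  have hsubn := fareySet_mono (le_refl m) (Nat.sub_le n 1)
  by_cases h1 : b < r
  · have hV : fareyV ⟨a, b, m, n⟩ = ⟨a, b, m - 1, n⟩ := by
      simp only [fareyV, hm.ne', hn.ne', if_false, ← hr, h1, if_true]
    rw [hV]
    exact ⟨⟨mem_fareySet_of_lt_div hn ha (hab.trans h1), mem_fareySet_of_lt_div hn hb h1, hab,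
      fun c hc => hadj c (hsubm hc)⟩, le_rfl, le_rfl,
      Or.inl ⟨by dsimp only; omega, rfl, hleft h1.le⟩⟩
  by_cases h2 : b = r
  · have hV : fareyV ⟨a, b, m, n⟩ = ⟨a, sInf {c | c ∈ fareySet (m - 1) n ∧ a < c}, m - 1, n⟩ := by
      simp only [fareyV, hm.ne', hn.ne', if_false, ← hr, h2, lt_irrefl, if_true]
    rw [hV]
    have hmem := Set.Nonempty.csInf_mem (s := {c | c ∈ fareySet (m - 1) n ∧ a < c})
      ⟨⊤, top_mem_fareySet _ _, hab.trans_le le_top⟩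
      ((finite_fareySet (m - 1) n).subset fun c hc => hc.1)
    refine ⟨⟨mem_fareySet_of_lt_div hn ha (hab.trans_eq h2), hmem.1, hmem.2, fun c hc hlt => ?_⟩, le_rfl,
      not_lt.1 fun hlt => hadj _ (hsubm hmem.1) ⟨hmem.2, hlt⟩,
      Or.inl ⟨by dsimp only; omega, rfl, hleft h2.le⟩⟩
    exact hlt.2.not_ge (sInf_le ⟨hc, hlt.1⟩)
  have hrb : r < b := lt_of_le_of_ne (not_lt.1 h1) (Ne.symm h2)
  by_cases h3 : a = r
  · have hV : fareyV ⟨a, b, m, n⟩ = ⟨sSup {c | c ∈ fareySet m (n - 1) ∧ c < b}, b, m, n - 1⟩ := by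
      simp only [fareyV, hm.ne', hn.ne', if_false, ← hr, h1, h2, h3, if_true]
    rw [hV]
    have hmem := Set.Nonempty.csSup_mem (s := {c | c ∈ fareySet m (n - 1) ∧ c < b})
      ⟨0, zero_mem_fareySet _ _, ha0.trans_lt hab⟩
      ((finite_fareySet m (n - 1)).subset fun c hc => hc.1)
    refine ⟨⟨hmem.1, mem_fareySet_of_div_lt hn hb hrb, hmem.2, fun c hc hlt => ?_⟩,
      not_lt.1 fun hlt => hadj _ (hsubn hmem.1) ⟨hlt, hmem.2⟩, le_rfl,
      Or.inr ⟨rfl, by dsimp only; omega, hright h3.ge⟩⟩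
    exact hlt.1.not_ge (le_sSup ⟨hc, hlt.2⟩)
  · have hV : fareyV ⟨a, b, m, n⟩ = ⟨a, b, m, n - 1⟩ := by
      simp only [fareyV, hm.ne', hn.ne', if_false, ← hr, h1, h2, h3]
    rw [hV]
    -- `m / n` is itself an element of `G_{m,n}`, so it cannot lie inside the interval.
    have hra : r < a := lt_of_le_of_ne (not_lt.1 fun h => hadj r hrmem ⟨h, hrb⟩) (Ne.symm h3)
    exact ⟨⟨mem_fareySet_of_div_lt hn ha hra, mem_fareySet_of_div_lt hn hb hrb, hab,
      fun c hc => hadj c (hsubn hc)⟩, le_rfl, le_rfl,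
      Or.inr ⟨rfl, by dsimp only; omega, hright hra.le⟩⟩

theorem mapsTo_fareyV (k : ℕ) : Set.MapsTo fareyV (fareyLevel (k + 1)) (fareyLevel k) := by
  intro z hz
  obtain ⟨hk, hz⟩ := mem_fareyLevel.1 hz
  obtain ⟨h, -, -, h'⟩ := fareyV_spec hz (by omega)
  refine mem_fareyLevel.2 ⟨?_, h⟩
  rcases h' with ⟨h1, h2, -⟩ | ⟨h1, h2, -⟩ <;> omega

theorem suranyi_fareyV {k : ℕ} {z : TaggedInterval} (hz : z ∈ fareyLevel (k + 1)) :
    suranyi (fareyV z) = diffU (suranyi z) := by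
  obtain ⟨hk, hz⟩ := mem_fareyLevel.1 hz
  obtain ⟨h, hle, hle', h'⟩ := fareyV_spec hz (by omega)
  obtain ⟨ξ, ha, hb⟩ := EReal.lt_iff_exists_real_btwn.1 hz.2.2.1
  have hξ := (hz.avoidsFractions ha hb).1
  rw [suranyi_eq_rankPair h (hle.trans_lt ha) (hb.trans_le hle'), suranyi_eq_rankPair hz ha hb]
  rcases h' with ⟨h1, h2, h3⟩ | ⟨h1, h2, h3⟩
  · have := h3 ξ ha hb
    rw [h2, h1, diffU_rankPair_of_mul_lt (by omega) hξ (by push_cast; linarith)]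
  · have := h3 ξ ha hb
    rw [h1, h2, diffU_rankPair_of_lt_mul (by omega) hξ (by push_cast; linarith)]

theorem youngPhi_suranyi {k : ℕ} {z : TaggedInterval} (hz : z ∈ fareyLevel k) :
    youngPhi (k + 2) (suranyi z) = suranyi (fareyV z) := by
  have : Nonempty TaggedInterval := ⟨z⟩
  rw [youngPhi, Nat.add_sub_cancel, (bijOn_suranyi k).injOn.leftInvOn_invFunOn hz]

theorem mapsTo_youngPhi (k : ℕ) :
    Set.MapsTo (youngPhi (k + 3)) (youngLevel (k + 3)) (youngLevel (k + 2)) := by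
  intro x hx
  obtain ⟨z, hz, rfl⟩ := (bijOn_suranyi (k + 1)).surjOn hx
  rw [youngPhi_suranyi hz]
  exact (bijOn_suranyi k).mapsTo (mapsTo_fareyV k hz)

theorem eqOn_youngPhi_diffU (k : ℕ) :
    Set.EqOn (youngPhi (k + 3)) diffU (youngLevel (k + 3)) := by
  intro x hx
  obtain ⟨z, hz, rfl⟩ := (bijOn_suranyi (k + 1)).surjOn hx
  rw [youngPhi_suranyi hz, suranyi_fareyV hz]

theorem youngTree_eq_diffTree (N : ℕ) : youngTree N = diffTree N := by
  simp only [youngTree, diffTree, treeOfLevels, youngLevel_eq_diffLevel, LeveledRootedTree.mk.injEq,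
    true_and]
  funext v w
  refine propext (exists_congr fun k => and_congr_right fun _ => or_congr ?_ ?_) <;>
  · refine and_congr_right fun _ => and_congr_right fun h => ?_
    rw [← youngLevel_eq_diffLevel] at h
    rw [eqOn_youngPhi_diffU k h]

theorem theorem1 :
    -- the inter-level maps and the map between the Farey intervals and the Young terminal pairs
    -- are well defined
    ((∀ k : ℕ, Set.MapsTo fareyV (fareyLevel (k + 1)) (fareyLevel k)) ∧
      (∀ k : ℕ, ∀ z ∈ fareyLevel k, ∃ ξ : ℝ, z.a < (ξ : EReal) ∧ (ξ : EReal) < z.b) ∧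
      (∀ k : ℕ, ∀ z ∈ fareyLevel k, ∀ ξ : ℝ, z.a < (ξ : EReal) → (ξ : EReal) < z.b →
        suranyi z = rankPair (z.m + 1) (z.n + 1) ξ) ∧
      (∀ k : ℕ, Set.BijOn suranyi (fareyLevel k) (youngLevel (k + 2))) ∧
      (∀ k : ℕ, 2 ≤ k → Set.MapsTo diffU (diffLevel (k + 1)) (diffLevel k)) ∧
      (∀ k : ℕ, 2 ≤ k → Set.MapsTo (youngPhi (k + 1)) (youngLevel (k + 1)) (youngLevel k)) ∧
      diffLevel 2 = {⟨1, 1, 1, 1⟩} ∧ youngLevel 2 = {⟨1, 1, 1, 1⟩}) ∧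
    -- the two trees are equal
    (∀ N : ℕ, youngTree N = diffTree N) ∧
    -- the sets of terminal pairs agree
    (∀ m n : ℕ, 1 ≤ m → 1 ≤ n → youngPairs m n = diffPairs m n) ∧
    -- the inter-level maps agree
    (∀ k : ℕ, 2 ≤ k →
      youngLevel (k + 1) = diffLevel (k + 1) ∧
        Set.EqOn (youngPhi (k + 1)) diffU (youngLevel (k + 1))) := by
  have hlevel : ∀ k : ℕ, 2 ≤ k →
      Set.MapsTo (youngPhi (k + 1)) (youngLevel (k + 1)) (youngLevel k) ∧
        Set.EqOn (youngPhi (k + 1)) diffU (youngLevel (k + 1)) := by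
    intro k hk
    obtain ⟨k, rfl⟩ := Nat.exists_eq_add_of_le' hk
    exact ⟨mapsTo_youngPhi k, eqOn_youngPhi_diffU k⟩
  refine ⟨⟨mapsTo_fareyV, fun k z hz => ?_, fun k z hz ξ ha hb => ?_, bijOn_suranyi,
    fun k hk => ?_, fun k hk => (hlevel k hk).1, ?_, youngLevel_two⟩, youngTree_eq_diffTree,
    fun m n hm hn => youngPairs_eq_diffPairs hm hn,
    fun k hk => ⟨youngLevel_eq_diffLevel _, (hlevel k hk).2⟩⟩
  · exact EReal.lt_iff_exists_real_btwn.1 (mem_fareyLevel.1 hz).2.2.2.1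
  · exact suranyi_eq_rankPair (mem_fareyLevel.1 hz).2 ha hb
  · rw [← youngLevel_eq_diffLevel, ← youngLevel_eq_diffLevel]
    -- That `diffU` stays within the levels is inherited from `youngPhi`, with which it agrees
    -- there.
    exact (hlevel k hk).1.congr (hlevel k hk).2
  · rw [← youngLevel_eq_diffLevel, youngLevel_two]
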